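/- Let $1\le m<\Delta$ be integers, $N=\binom{\Delta}{m}$, and let $\pi$ be any bijection from the set $\binom{[\Delta]}{m}$ of $m$-element subsets of $[\Delta]=\{1,\dots,\Delta\}$ onto $[N]$. The intersection graph $\sqcap_{\Delta,m}$ has $N$ storage nodes $Q_1,\dots,Q_N$ and the decoding sets $\mathcal E=\{e_1,\dots,e_\Delta\}$, where $e_i=\{\pi(\mathcal S): \mathcal S\in\binom{[\Delta]}{m},\ i\in \mathcal S\}$. Its storage capacity under uniform storage is $$C_u(\sqcap_{\Delta,m})=\binom{\Delta-2}{m-2},$$ with the convention that $\binom{\Delta-2}{-1}=0$ (the case $m=1$). Here the uniform storage capacity $C_u$ is the supremum, over all integers $q\ge 2$ and $\kappa\ge 1$, of all real $\lambda_0$ for which there are finite-dimensional quantum systems $Q_0,Q_1,\dots,Q_N$ (nonzero complex Hilbert spaces) with $\log_q\dim Q_0=\kappa\lambda_0$ and $\log_q\dim Q_n\le\kappa$ for all $n\in[N]$, a completely positive trace preserving (CPTP) map $\mathrm{ENC}$ from operators on $Q_0$ to operators on $Q_1\otimes\cdots\otimes Q_N$, and for every $e\in\mathcal E$ a CPTP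 map $\mathrm{DEC}^e$ from operators on $\bigotimes_{n\in e}Q_n$ to operators on $Q_0$, such that for every $e\in\mathcal E$ and every unit vector $\varphi\in R\otimes Q_0$, where $R$ is a reference system with $\dim R=\dim Q_0$, $$\bigl(I_R\otimes(\mathrm{DEC}^e\circ \mathrm{Tr}_{[N]\setminus e}\circ\mathrm{ENC})\bigr)(|\varphi\rangle\langle\varphi|)=|\varphi\rangle\langle\varphi| .$$ Here $\mathrm{Tr}_{[N]\setminus e}$ is the partial trace over the nodes outside $e$. -/

import Mathlib

open scoped Matrix ComplexOrder

noncomputable section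

namespace QStorage

/-- Operators on the Hilbert space `ℂ^n` (with its standard orthonormal basis indexed by `n`). -/
abbrev Op (n : Type) : Type := Matrix n n ℂ

/-- `I_R ⊗ Φ`: the linear map `Φ` acts on the second factor of `ℂ^R ⊗ ℂ^n`, and the first factor
(the reference system) is left untouched. -/
def ampliation (R : Type) {n n' : Type} (Φ : Op n →ₗ[ℂ] Op n') (M : Op (R × n)) : Op (R × n') :=
  Matrix.of fun a b => Φ (Matrix.of fun i j => M (a.1, i) (b.1, j)) a.2 b.2

/-- Completely positive trace preserving maps: `I_k ⊗ Φ` preserves positive semidefiniteness for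
every `k`, and `Φ` preserves the trace. -/
structure IsCPTP {n n' : Type} [Fintype n] [Fintype n'] (Φ : Op n →ₗ[ℂ] Op n') : Prop where
  completelyPositive : ∀ (k : ℕ) (M : Op (Fin k × n)),
    M.PosSemidef → (ampliation (Fin k) Φ M).PosSemidef
  tracePreserving : ∀ M : Op n, (Φ M).trace = M.trace

/-- The computational basis of the composite system of the nodes in `V`, where node `v` is a system
of dimension `d v`; thus `⊗_v ℂ^(d v)` is `ℂ^(JointBasis d)`. -/
abbrev JointBasis {V : Type} (d : V → ℕ) : Type := (v : V) → Fin (d v)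

/-- The computational basis of the composite system of only those nodes that lie in `e`. -/
abbrev SubBasis {V : Type} (d : V → ℕ) (e : Finset V) : Type := (v : {v // v ∈ e}) → Fin (d v)

/-- The erasure channel: the partial trace over all nodes outside `e`. -/
def erase {V : Type} [Fintype V] [DecidableEq V] (d : V → ℕ) (e : Finset V) :
    Op (JointBasis d) →ₗ[ℂ] Op (SubBasis d e) where
  toFun M := Matrix.of fun x y =>
    ∑ z : (v : {v // ¬ v ∈ e}) → Fin (d v),
      M ((Equiv.piEquivPiSubtypeProd (fun v => v ∈ e) fun v => Fin (d v)).symm (x, z))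
        ((Equiv.piEquivPiSubtypeProd (fun v => v ∈ e) fun v => Fin (d v)).symm (y, z))
  map_add' M M' := by
    ext x y
    simp [Finset.sum_add_distrib]
  map_smul' c M := by
    ext x y
    simp [Finset.mul_sum]

/-- A storage graph on the set `V` of storage nodes: the relative size of each node, and the set of
hyperedges, i.e. the decoding sets. -/
structure StorageGraph (V : Type) where
  size : V → ℝ
  decodingSets : Set (Finset V)

/-- A perfect storage code: a message of dimension `d₀` is encoded into nodes of dimensions `d v`
by one channel `enc`, and for each decoding set `e` there is a channel which, applied to the nodes
in `e` only, restores every pure state of reference (of dimension `d₀`) and message. -/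
def HasCode {V : Type} [Fintype V] [DecidableEq V] (E : Set (Finset V)) (d : V → ℕ) (d₀ : ℕ) :
    Prop :=
  ∃ enc : Op (Fin d₀) →ₗ[ℂ] Op (JointBasis d), IsCPTP enc ∧
    ∀ e ∈ E, ∃ dec : Op (SubBasis d e) →ₗ[ℂ] Op (Fin d₀), IsCPTP dec ∧
      ∀ φ : Fin d₀ × Fin d₀ → ℂ, star φ ⬝ᵥ φ = 1 →
        ampliation (Fin d₀) (dec ∘ₗ erase d e ∘ₗ enc) (Matrix.vecMulVec φ (star φ)) =
          Matrix.vecMulVec φ (star φ)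

/-- `(G, q, κ)` fits a quantum message of `κ * l` qudits (`q`-dimensional units), when node `v` may
hold at most `κ * G.size v` qudits. -/
def StorageGraph.Fits {V : Type} [Fintype V] [DecidableEq V] (G : StorageGraph V) (q κ : ℕ)
    (l : ℝ) : Prop :=
  ∃ (d : V → ℕ) (d₀ : ℕ),
    (∀ v, 0 < d v ∧ Real.logb q (d v) ≤ κ * G.size v) ∧
    (0 < d₀ ∧ Real.logb q d₀ = κ * l) ∧
    HasCode G.decodingSets d d₀

/-- The storage capacity, as a supremum in the extended reals (so that no boundedness is
presupposed). -/
def StorageGraph.capacity {V : Type} [Fintype V] [DecidableEq V] (G : StorageGraph V) : EReal :=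
  ⨆ (q : ℕ) (_ : 2 ≤ q) (κ : ℕ) (_ : 1 ≤ κ), ⨆ (l : ℝ) (_ : G.Fits q κ l), (l : EReal)

/-- The intersection graph on the node set `V`, whose nodes are labelled bijectively (by `π`) by
the `m`-element subsets of a `Δ`-element set. The decoding set `e_i` consists of the nodes whose
label contains `i`. -/
def intersectionGraph {V : Type} [Fintype V] {Δ m : ℕ}
    (π : {S : Finset (Fin Δ) // S.card = m} ≃ V) (size : V → ℝ) : StorageGraph V where
  size := size
  decodingSets := Set.range fun i : Fin Δ => Finset.univ.filter fun v : V => i ∈ (π.symm v).1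

end QStorage

end

noncomputable section

namespace QStorage

/-! Upper bound. By no-cloning, if `e₁` recovers the message, the nodes outside `e₁` are
uncorrelated with the reference. Split `e₂` into A = `e₁ ∩ e₂` and B = `e₂ \ e₁`. Encoding half of
the unnormalised maximally entangled state Ω on two n-dimensional systems gives an operator M on RAB
whose RB marginal is 1_R ⊗ τ. The inequality M ≤ |A| · 1_A ⊗ Tr_A M, pushed through the decoder of
`e₂`, becomes Ω ≤ 1_R ⊗ Y with tr Y = |A|²; the expectation in the vector ∑ |ii⟩ gives n² ≤ |A|². No
entropies are needed. Hence n is at most the joint dimension of the shared nodes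
(`HasCode.le_prod_inter`), and any two of the `e_i` share C(Δ-2, m-2) nodes.

Lower bound, m ≥ 2. Place on the node labelled S the value at S of a cocycle on the full simplex
with vertex set [Δ], over a field of characteristic 2. A cocycle is determined by its values on the
star of a vertex i, which are arbitrary, so `e_i` carries the whole codeword. The message is the
contraction of the cocycle with a weight w that is nowhere zero and has sum zero. Contraction is
blind to no direction on the star: the values off the star of i and the message can be prescribed
independently and together fix the codeword. The coset code built from these data
(`hasCode_of_codewords`) is therefore decodable from each `e_i`. The possible messages are the
cocycles of degree m-1 killed by contraction, a space of dimension C(Δ-2, m-2). -/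

/-! ### Positivity of block operators -/

theorem posSemidef_scale {n : Type} [Fintype n] {M : Op n} (hM : M.PosSemidef)
    (c : n → ℂ) : (Matrix.of fun p q => c p * M p q * star (c q) : Op n).PosSemidef := by
  classical
  have h := hM.mul_mul_conjTranspose_same (Matrix.diagonal c)
  convert h using 1
  ext p q
  simp [Matrix.diagonal_conjTranspose]

/-- Complete positivity for an arbitrary finite reference system. -/
theorem IsCPTP.posSemidef_ampliation {R n n' : Type} [Fintype R] [Fintype n] [Fintype n']
    {Φ : Op n →ₗ[ℂ] Op n'} (hΦ : IsCPTP Φ) {M : Op (R × n)} (hM : M.PosSemidef) :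
    (ampliation R Φ M).PosSemidef := by
  have h := hΦ.completelyPositive _ _
    (hM.submatrix fun p : Fin (Fintype.card R) × n => ((Fintype.equivFin R).symm p.1, p.2))
  have h' := h.submatrix fun p : R × n' => (Fintype.equivFin R p.1, p.2)
  convert h' using 1
  ext p q
  simp [ampliation]

/-- The unnormalised maximally entangled state `∑ |i⟩⟨j| ⊗ |i⟩⟨j|`. -/
def maxEntangled (R : Type) [DecidableEq R] : Op (R × R) :=
  Matrix.of fun a b => Matrix.single a.1 b.1 (1 : ℂ) a.2 b.2

theorem maxEntangled_eq_vecMulVec (R : Type) [DecidableEq R] :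
    maxEntangled R = Matrix.vecMulVec (fun p : R × R => if p.1 = p.2 then (1 : ℂ) else 0)
      (star fun p : R × R => if p.1 = p.2 then (1 : ℂ) else 0) := by
  ext p q
  simp only [maxEntangled, Matrix.of_apply, Matrix.single_apply, Matrix.vecMulVec_apply,
    Pi.star_apply]
  split_ifs <;> simp_all

theorem maxEntangled_posSemidef (R : Type) [Fintype R] [DecidableEq R] :
    (maxEntangled R).PosSemidef := by
  rw [maxEntangled_eq_vecMulVec]
  exact Matrix.posSemidef_vecMulVec_self_star _

/-- A PSD operator whose partial trace over `Z` is the maximally entangled state is a product. -/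
theorem exists_environment_state {R Z : Type} [Fintype R] [DecidableEq R] [Fintype Z]
    {ω : Op ((R × Z) × R)} (hω : ω.PosSemidef)
    (hΩ : ∀ i a j b, ∑ z, ω ((i, z), a) ((j, z), b) = maxEntangled R (i, a) (j, b)) :
    ∃ σ : Z → Z → ℂ, ∀ i j z z',
      ∑ a, ω ((i, z), a) ((j, z'), a) = if i = j then σ z z' else 0 := by
  classical
  have hcol : ∀ x : (R × Z) × R → ℂ, star x ⬝ᵥ (ω *ᵥ x) = 0 → ω *ᵥ x = 0 :=
    fun x hx => (hω.dotProduct_mulVec_zero_iff x).1 hx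
  have hoff : ∀ i z a, i ≠ a → ∀ p, ω p ((i, z), a) = 0 := by
    intro i z a hia p
    have h0 : ω ((i, z), a) ((i, z), a) = 0 := by
      have h := hΩ i a i a
      rw [maxEntangled, Matrix.of_apply, Matrix.single_apply, if_neg (by simp [hia])] at h
      exact (Finset.sum_eq_zero_iff_of_nonneg fun z _ => hω.diag_nonneg).1 h z (Finset.mem_univ z)
    have h := congrFun (hcol (Pi.single ((i, z), a) 1) (by simp [h0])) p
    simpa using h
  have hoff' : ∀ i z a, i ≠ a → ∀ p, ω ((i, z), a) p = 0 := by
    intro i z a hia p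
    rw [← hω.isHermitian.apply, hoff i z a hia, star_zero]
  -- The quadratic form of ω at the difference of the two basis vectors is nonnegative for each z
  -- and sums over z to 1 - 1 - 1 + 1 = 0, so each such vector lies in the kernel of ω.
  have hdiag : ∀ i j z p, ω p ((i, z), i) = ω p ((j, z), j) := by
    intro i j z p
    let x : Z → (R × Z) × R → ℂ := fun z => Pi.single ((i, z), i) 1 - Pi.single ((j, z), j) 1
    have hx : ∀ z, star (x z) ⬝ᵥ (ω *ᵥ x z) =
        ω ((i, z), i) ((i, z), i) - ω ((j, z), j) ((i, z), i)
          - (ω ((i, z), i) ((j, z), j) - ω ((j, z), j) ((j, z), j)) := by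
      intro z
      simp [x, Matrix.mulVec_sub, sub_dotProduct]
    have hs : ∑ z, star (x z) ⬝ᵥ (ω *ᵥ x z) = 0 := by
      simp only [hx, Finset.sum_sub_distrib, hΩ]
      simp [maxEntangled]
    have h0 := (Finset.sum_eq_zero_iff_of_nonneg fun z _ =>
      hω.dotProduct_mulVec_nonneg (x z)).1 hs z (Finset.mem_univ z)
    have h := congrFun (hcol _ h0) p
    simp only [x, Matrix.mulVec_sub, Pi.sub_apply, Matrix.mulVec_single_one, Matrix.col_apply,
      Pi.zero_apply] at h
    exact sub_eq_zero.1 h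
  have hdiag' : ∀ i j z p, ω ((i, z), i) p = ω ((j, z), j) p := by
    intro i j z p
    rw [← hω.isHermitian.apply, hdiag i j z, hω.isHermitian.apply]
  rcases isEmpty_or_nonempty R with hR | ⟨⟨r⟩⟩
  · exact ⟨0, fun i => hR.elim i⟩
  refine ⟨fun z z' => ω ((r, z), r) ((r, z'), r), fun i j z z' => ?_⟩
  rw [Finset.sum_eq_single i]
  · split_ifs with h
    · subst h
      rw [hdiag i r, hdiag' i r]
    · exact hoff _ _ _ (Ne.symm h) _
  · intro a _ ha
    exact hoff' _ _ _ ha.symm _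
  · simp

/-- The operator inequality `M ≤ |A| • (1_A ⊗ Tr_A M)`. -/
theorem posSemidef_card_smul_sub {A X : Type} [Fintype A] [DecidableEq A] [Fintype X]
    {M : Op (A × X)} (hM : M.PosSemidef) :
    (Matrix.of fun p q => (if p.1 = q.1 then (Fintype.card A : ℂ) * ∑ b, M (b, p.2) (b, q.2) else 0)
      - M p q : Op (A × X)).PosSemidef := by
  -- With P_a the projection onto a in A, the gap equals ½ ∑_{a,b} (P_a - P_b) M (P_a - P_b) + |A|
  -- ∑_a ∑_{b≠a} |a⟩⟨b| M |b⟩⟨a|.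
  let c : A → A → A × X → ℂ := fun a b p => (if p.1 = a then 1 else 0) - (if p.1 = b then 1 else 0)
  have h1 : ((1 / 2 : ℝ) • ∑ a, ∑ b, (Matrix.of fun p q => c a b p * M p q * star (c a b q) :
      Op (A × X))).PosSemidef :=
    (Matrix.posSemidef_sum _ fun a _ => Matrix.posSemidef_sum _ fun b _ =>
      posSemidef_scale hM _).smul (by norm_num)
  have h2 : ((Fintype.card A : ℝ) • ∑ a : A, ∑ b ∈ Finset.univ.erase a,
      (Matrix.of fun p q => (if p.1 = a then (1 : ℂ) else 0) *
        (M.submatrix (fun p : A × X => (b, p.2)) fun p => (b, p.2)) p q *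
        star (if q.1 = a then (1 : ℂ) else 0) : Op (A × X))).PosSemidef :=
    (Matrix.posSemidef_sum _ fun a _ => Matrix.posSemidef_sum _ fun b _ =>
      posSemidef_scale (hM.submatrix _) _).smul (by positivity)
  convert h1.add h2 using 1
  ext ⟨a, x⟩ ⟨b, y⟩
  have e1 : ∑ k, ∑ l, c k l (a, x) * M (a, x) (b, y) * star (c k l (b, y)) =
      M (a, x) (b, y) * (if a = b then 2 * (Fintype.card A : ℂ) - 2 else - 2) := by
    have : ∀ k l, c k l (a, x) * M (a, x) (b, y) * star (c k l (b, y)) = M (a, x) (b, y) *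
        ((if a = k then if b = k then 1 else 0 else 0) - (if a = k then if b = l then 1 else 0 else 0)
        - (if a = l then if b = k then 1 else 0 else 0) +
        (if a = l then if b = l then 1 else 0 else 0)) := by
      intro k l
      simp only [c]
      split_ifs <;> simp
    simp only [this, ← Finset.mul_sum, Finset.sum_sub_distrib, Finset.sum_add_distrib]
    congr 1
    simp [Finset.sum_ite_eq]
    by_cases h : a = b
    · simp [h]; ring
    · simp [h, Ne.symm h]; norm_num
  have e2 : ∑ k : A, ∑ l ∈ Finset.univ.erase k, ((if a = k then (1 : ℂ) else 0) *
      M (l, x) (l, y) * star (if b = k then (1 : ℂ) else 0)) =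
      if a = b then ∑ l, M (l, x) (l, y) - M (a, x) (b, y) else 0 := by
    rw [Finset.sum_eq_single a]
    · by_cases h : a = b
      · subst h
        simp [Finset.sum_erase_eq_sub]
      · simp [h, Ne.symm h]
    · intro k _ hk
      simp [hk.symm]
    · simp
  simp only [Matrix.add_apply, Matrix.smul_apply, Matrix.sum_apply, Matrix.of_apply,
    Matrix.submatrix_apply]
  rw [e1, e2]
  by_cases h : a = b
  · simp [h]; ring
  · simp [h]; ring

/-! ### Upper bound: message dimension versus shared nodes -/

section

/-- A single test state suffices: the blocks of the normalised maximally entangled state are the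
matrix units divided by n. -/
theorem map_single_of_perfect {n : ℕ} (hn : 0 < n) (Φ : Op (Fin n) →ₗ[ℂ] Op (Fin n))
    (h : ∀ φ : Fin n × Fin n → ℂ, star φ ⬝ᵥ φ = 1 →
      ampliation (Fin n) Φ (Matrix.vecMulVec φ (star φ)) = Matrix.vecMulVec φ (star φ))
    (i j : Fin n) : Φ (Matrix.single i j 1) = Matrix.single i j 1 := by
  let c : ℂ := ((Real.sqrt n)⁻¹ : ℝ)
  have hc : c * c = (n : ℂ)⁻¹ := by
    simp only [c]
    rw [← Complex.ofReal_mul, ← mul_inv, Real.mul_self_sqrt (Nat.cast_nonneg n)]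
    simp
  have hcs : star c = c := Complex.conj_ofReal _
  have hn0 : (n : ℂ) ≠ 0 := by exact_mod_cast hn.ne'
  let ψ : Fin n × Fin n → ℂ := fun p => if p.1 = p.2 then (1 : ℂ) else 0
  have hψ : Matrix.vecMulVec (c • ψ) (star (c • ψ)) = (n : ℂ)⁻¹ • maxEntangled (Fin n) := by
    rw [maxEntangled_eq_vecMulVec, star_smul, Matrix.vecMulVec_smul, Matrix.smul_vecMulVec,
      smul_smul, hcs, hc]
  have hu : star (c • ψ) ⬝ᵥ (c • ψ) = 1 := by
    rw [star_smul, smul_dotProduct, dotProduct_smul, smul_smul, hcs, hc]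
    simp [ψ, dotProduct, Fintype.sum_prod_type, apply_ite, hn0]
  have h1 := h _ hu
  rw [hψ] at h1
  ext a b
  have h2 := congrFun (congrFun h1 (i, a)) (j, b)
  have h3 : (Matrix.of fun k l => ((n : ℂ)⁻¹ • maxEntangled (Fin n)) (i, k) (j, l) : Op (Fin n))
      = (n : ℂ)⁻¹ • Matrix.single i j 1 := by
    ext k l
    simp [maxEntangled]
  rw [ampliation, Matrix.of_apply, h3, map_smul] at h2
  simpa [maxEntangled, hn0] using h2

variable {V : Type} [Fintype V] [DecidableEq V]

/-- The information in `e₁` being sufficient to recover the message, the complement of `e₁` is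
uncorrelated with the message. -/
theorem exists_complement_state {n : ℕ} (d : V → ℕ) (e : Finset V)
    {enc : Op (Fin n) →ₗ[ℂ] Op (JointBasis d)} (henc : IsCPTP enc)
    {dec : Op (SubBasis d e) →ₗ[ℂ] Op (Fin n)} (hdec : IsCPTP dec)
    (h : ∀ i j, dec (erase d e (enc (Matrix.single i j 1))) = Matrix.single i j 1) :
    ∃ σ : ((v : {v // ¬ v ∈ e}) → Fin (d v)) → ((v : {v // ¬ v ∈ e}) → Fin (d v)) → ℂ,
      ∀ i j z z', ∑ x : SubBasis d e, enc (Matrix.single i j 1)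
        ((Equiv.piEquivPiSubtypeProd (fun v => v ∈ e) fun v => Fin (d v)).symm (x, z))
        ((Equiv.piEquivPiSubtypeProd (fun v => v ∈ e) fun v => Fin (d v)).symm (x, z')) =
        if i = j then σ z z' else 0 := by
  let ε := Equiv.piEquivPiSubtypeProd (fun v => v ∈ e) fun v => Fin (d v)
  have hρ := henc.posSemidef_ampliation (maxEntangled_posSemidef (Fin n))
  -- The nodes outside `e` are regrouped with the reference, so that the decoder acts on `e` alone.
  have hρ' := hρ.submatrix fun p : (Fin n × ((v : {v // ¬ v ∈ e}) → Fin (d v))) × SubBasis d e =>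
    (p.1.1, ε.symm (p.2, p.1.2))
  have hω := hdec.posSemidef_ampliation hρ'
  obtain ⟨σ, hσ⟩ := exists_environment_state hω (by
    intro i a j b
    have h0 := congrFun (congrFun (h i j) a) b
    have h1 : erase d e (enc (Matrix.single i j 1)) = ∑ z : ((v : {v // ¬ v ∈ e}) → Fin (d v)),
        (Matrix.of fun x y => enc (Matrix.single i j 1) (ε.symm (x, z)) (ε.symm (y, z))) := by
      ext x y
      simp [erase, Matrix.sum_apply, ε]
    rw [h1, map_sum, Matrix.sum_apply] at h0
    exact h0)
  refine ⟨σ, fun i j z z' => ?_⟩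
  rw [← hσ i j z z']
  -- Tracing out the decoder's output is the same as tracing out `e`.
  exact (hdec.tracePreserving
    (Matrix.of fun x y => enc (Matrix.single i j 1) (ε.symm (x, z)) (ε.symm (y, z')))).symm

/-- The first decoder serves only to decouple `e₂ \ e₁` from the reference; the second is applied to
the operator inequality for the partial trace over `e₁ ∩ e₂`. -/
theorem card_le_of_decode {n : ℕ} (hn : 0 < n) (d : V → ℕ) (e₁ e₂ : Finset V)
    {enc : Op (Fin n) →ₗ[ℂ] Op (JointBasis d)} (henc : IsCPTP enc)
    {dec₁ : Op (SubBasis d e₁) →ₗ[ℂ] Op (Fin n)} (hdec₁ : IsCPTP dec₁)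
    (h₁ : ∀ i j, dec₁ (erase d e₁ (enc (Matrix.single i j 1))) = Matrix.single i j 1)
    {dec₂ : Op (SubBasis d e₂) →ₗ[ℂ] Op (Fin n)} (hdec₂ : IsCPTP dec₂)
    (h₂ : ∀ i j, dec₂ (erase d e₂ (enc (Matrix.single i j 1))) = Matrix.single i j 1) :
    n ≤ Fintype.card ((v : {v : {v // v ∈ e₂} // v.1 ∈ e₁}) → Fin (d v.1)) := by
  let A := (v : {v : {v // v ∈ e₂} // v.1 ∈ e₁}) → Fin (d v.1)
  let B := (v : {v : {v // v ∈ e₂} // ¬ v.1 ∈ e₁}) → Fin (d v.1)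
  let ε₁ := Equiv.piEquivPiSubtypeProd (fun v => v ∈ e₁) fun v => Fin (d v)
  let ε₂ := Equiv.piEquivPiSubtypeProd (fun v => v ∈ e₂) fun v => Fin (d v)
  let ε : SubBasis d e₂ ≃ A × B :=
    Equiv.piEquivPiSubtypeProd (fun v : {v // v ∈ e₂} => v.1 ∈ e₁) fun v => Fin (d v)
  obtain ⟨σ, hσ⟩ := exists_complement_state d e₁ henc hdec₁ h₁
  let β : JointBasis d → B := fun s v => s v.1
  -- Overwriting the B coordinates of s by b' lets the (b, b') entry of the B marginal be written as
  -- one sum over s, which is then sliced along `e₁` in `hsum₁` and along `e₂` in `hsum₂`.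
  let upd : JointBasis d → B → JointBasis d := fun s b v =>
    if h : v ∈ e₂ then if h' : v ∈ e₁ then s v else b ⟨⟨v, h⟩, h'⟩ else s v
  let τ : B → B → ℂ := fun b b' => ∑ z : ((v : {v // ¬ v ∈ e₁}) → Fin (d v)),
    if (fun v => z ⟨v.1, v.2⟩ : B) = b then
      σ z (fun v => if h : v.1 ∈ e₂ then b' ⟨⟨v.1, h⟩, v.2⟩ else z v) else 0
  let N : Fin n → Fin n → Op (SubBasis d e₂) := fun i j => erase d e₂ (enc (Matrix.single i j 1))
  have hsum₁ : ∀ i j b b', (∑ s : JointBasis d, if β s = b then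
      enc (Matrix.single i j 1) s (upd s b') else 0) = if i = j then τ b b' else 0 := by
    intro i j b b'
    rw [← ε₁.symm.sum_comp, Fintype.sum_prod_type_right]
    have : (if i = j then τ b b' else 0) = ∑ z : ((v : {v // ¬ v ∈ e₁}) → Fin (d v)),
      if (fun v => z ⟨v.1, v.2⟩ : B) = b then (if i = j then
        σ z (fun v => if h : v.1 ∈ e₂ then b' ⟨⟨v.1, h⟩, v.2⟩ else z v) else 0) else 0 := by
      split_ifs <;> simp [τ]
    rw [this]
    refine Finset.sum_congr rfl fun z _ => ?_
    have hβ : ∀ x, β (ε₁.symm (x, z)) = (fun v => z ⟨v.1, v.2⟩ : B) := by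
      intro x
      funext v
      simp [β, ε₁, Equiv.piEquivPiSubtypeProd, v.2]
    have hu : ∀ x, upd (ε₁.symm (x, z)) b' =
        ε₁.symm (x, fun v => if h : v.1 ∈ e₂ then b' ⟨⟨v.1, h⟩, v.2⟩ else z v) := by
      intro x
      funext v
      by_cases h : v ∈ e₁ <;> by_cases h' : v ∈ e₂ <;>
        simp [upd, ε₁, Equiv.piEquivPiSubtypeProd, h, h']
    simp only [hβ, hu]
    by_cases hb : (fun v => z ⟨v.1, v.2⟩ : B) = b
    · simp only [if_pos hb]
      exact hσ i j _ _
    · simp only [if_neg hb, Finset.sum_const_zero]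
  have hsum₂ : ∀ i j b b', (∑ s : JointBasis d, if β s = b then
      enc (Matrix.single i j 1) s (upd s b') else 0) =
      ∑ a, N i j (ε.symm (a, b)) (ε.symm (a, b')) := by
    intro i j b b'
    rw [← ε₂.symm.sum_comp, Fintype.sum_prod_type, ← ε.symm.sum_comp, Fintype.sum_prod_type]
    refine Finset.sum_congr rfl fun a _ => ?_
    have hβ : ∀ b z, β (ε₂.symm (ε.symm (a, b), z)) = b := by
      intro b z
      funext v
      simp [β, ε₂, ε, Equiv.piEquivPiSubtypeProd, v.2]
    have hu : ∀ b z, upd (ε₂.symm (ε.symm (a, b), z)) b' = ε₂.symm (ε.symm (a, b'), z) := by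
      intro b z
      funext v
      by_cases h : v ∈ e₁ <;> by_cases h' : v ∈ e₂ <;>
        simp [upd, ε₂, ε, Equiv.piEquivPiSubtypeProd, h, h']
    simp only [hβ, hu]
    rw [Finset.sum_eq_single b]
    · simp [N, erase, ε₂]
    · intro b'' _ hb
      simp [hb]
    · simp
  have hN : ∀ i j b b', ∑ a, N i j (ε.symm (a, b)) (ε.symm (a, b')) = if i = j then τ b b' else 0 :=
    fun i j b b' => (hsum₂ i j b b').symm.trans (hsum₁ i j b b')
  have htr : ∑ b, τ b b = 1 := by
    let i : Fin n := ⟨0, hn⟩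
    have h1 : (N i i).trace = 1 := by
      rw [← hdec₂.tracePreserving, h₂]
      simp
    rw [← h1, Matrix.trace, ← ε.symm.sum_comp, Fintype.sum_prod_type_right]
    refine Finset.sum_congr rfl fun b _ => ?_
    simpa using (hN i i b b).symm
  have hNpsd : (Matrix.of fun p q => N p.1 q.1 p.2 q.2 :
      Op (Fin n × SubBasis d e₂)).PosSemidef := by
    have hρ := henc.posSemidef_ampliation (maxEntangled_posSemidef (Fin n))
    have := Matrix.posSemidef_sum Finset.univ
      fun z (_ : z ∈ (Finset.univ : Finset ((v : {v // ¬ v ∈ e₂}) → Fin (d v)))) =>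
        hρ.submatrix fun p : Fin n × SubBasis d e₂ => (p.1, ε₂.symm (p.2, z))
    convert this using 1
    ext p q
    simp only [Matrix.sum_apply]
    rfl
  have hgap := posSemidef_card_smul_sub (hNpsd.submatrix
    fun p : A × (Fin n × B) => (p.2.1, ε.symm (p.1, p.2.2)))
  have hgap' := hdec₂.posSemidef_ampliation (hgap.submatrix
    fun p : Fin n × SubBasis d e₂ => ((ε p.2).1, (p.1, (ε p.2).2)))
  let T : Op (SubBasis d e₂) := Matrix.of fun x y => if (ε x).1 = (ε y).1 then
    (Fintype.card A : ℂ) * τ (ε x).2 (ε y).2 else 0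
  have hG : (Matrix.of fun p q => (if p.1 = q.1 then dec₂ T p.2 q.2 else 0) -
      maxEntangled (Fin n) p q : Op (Fin n × Fin n)).PosSemidef := by
    convert hgap' using 1
    ext ⟨i, a⟩ ⟨j, b⟩
    have hM : ∀ M : Op (SubBasis d e₂), M = (if i = j then T else 0) - N i j →
        dec₂ M a b = (if i = j then dec₂ T a b else 0) - maxEntangled (Fin n) (i, a) (j, b) := by
      rintro _ rfl
      rw [map_sub, h₂]
      split_ifs <;> simp [maxEntangled]
    refine (hM _ ?_).symm
    ext x y
    simp only [Matrix.of_apply, Matrix.submatrix_apply, Prod.mk.eta, Equiv.symm_apply_apply,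
      Matrix.sub_apply, hN]
    by_cases hij : i = j <;> simp [hij, T]
  -- In this vector 1 ⊗ Y has expectation tr Y, and Ω has expectation n².
  have hpos := hG.dotProduct_mulVec_nonneg (fun p => if p.1 = p.2 then 1 else 0)
  have hT : T.trace = (Fintype.card A : ℂ) ^ 2 := by
    rw [Matrix.trace, ← ε.symm.sum_comp, Fintype.sum_prod_type]
    simp [T, ← Finset.mul_sum, htr]
    ring
  have hval : star (fun p : Fin n × Fin n => if p.1 = p.2 then (1 : ℂ) else 0) ⬝ᵥ
      ((Matrix.of fun p q => (if p.1 = q.1 then dec₂ T p.2 q.2 else 0) -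
      maxEntangled (Fin n) p q : Op (Fin n × Fin n)) *ᵥ fun p => if p.1 = p.2 then 1 else 0) =
      (Fintype.card A : ℂ) ^ 2 - (n : ℂ) ^ 2 := by
    rw [← hT, ← hdec₂.tracePreserving T]
    simp [dotProduct, Matrix.mulVec, Fintype.sum_prod_type, apply_ite, maxEntangled,
      Finset.sum_sub_distrib, Matrix.trace]
    ring
  rw [hval, sub_nonneg] at hpos
  have : n ^ 2 ≤ Fintype.card A ^ 2 := by exact_mod_cast hpos
  exact (Nat.pow_le_pow_iff_left two_ne_zero).1 this

/-- The dimension of the message is at most the joint dimension of the nodes shared by two decoding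
sets. -/
theorem HasCode.le_prod_inter {E : Set (Finset V)} {d : V → ℕ} {n : ℕ} (h : HasCode E d n)
    (hn : 0 < n) {e₁ e₂ : Finset V} (he₁ : e₁ ∈ E) (he₂ : e₂ ∈ E) :
    n ≤ ∏ v ∈ e₁ ∩ e₂, d v := by
  obtain ⟨enc, henc, hdec⟩ := h
  obtain ⟨dec₁, hdec₁, h₁⟩ := hdec e₁ he₁
  obtain ⟨dec₂, hdec₂, h₂⟩ := hdec e₂ he₂
  refine (card_le_of_decode hn d e₁ e₂ henc hdec₁ (map_single_of_perfect hn _ h₁) hdec₂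
    (map_single_of_perfect hn _ h₂)).trans_eq ?_
  rw [Fintype.card_pi]
  simp only [Fintype.card_fin]
  refine Finset.prod_bij (fun v _ => v.1.1) ?_ ?_ ?_ ?_
  · intro v _
    exact Finset.mem_inter.2 ⟨v.2, v.1.2⟩
  · intro v _ w _ hvw
    exact Subtype.ext (Subtype.ext hvw)
  · intro v hv
    exact ⟨⟨⟨v, (Finset.mem_inter.1 hv).2⟩, (Finset.mem_inter.1 hv).1⟩, Finset.mem_univ _, rfl⟩
  · simp

theorem StorageGraph.Fits.le_card_inter {G : StorageGraph V} {q κ : ℕ} {l : ℝ} (hq : 2 ≤ q)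
    (hκ : 1 ≤ κ) (hG : ∀ v, G.size v = 1) (h : G.Fits q κ l) {e₁ e₂ : Finset V}
    (he₁ : e₁ ∈ G.decodingSets) (he₂ : e₂ ∈ G.decodingSets) : l ≤ (e₁ ∩ e₂).card := by
  obtain ⟨d, n, hd, ⟨hn, hl⟩, hc⟩ := h
  have hq1 : (1 : ℝ) < q := by exact_mod_cast hq
  have hκ0 : (0 : ℝ) < κ := by exact_mod_cast hκ
  have h1 : (n : ℝ) ≤ ∏ v ∈ e₁ ∩ e₂, (d v : ℝ) := by
    exact_mod_cast hc.le_prod_inter hn he₁ he₂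
  have h2 : κ * l ≤ ∑ v ∈ e₁ ∩ e₂, Real.logb q (d v) := by
    rw [← hl, ← Real.logb_prod _ _ fun v _ => by exact_mod_cast (hd v).1.ne']
    exact Real.logb_le_logb_of_le hq1 (by exact_mod_cast hn) h1
  have h3 : ∑ v ∈ e₁ ∩ e₂, Real.logb q (d v) ≤ κ * (e₁ ∩ e₂).card := by
    calc _ ≤ ∑ v ∈ e₁ ∩ e₂, (κ : ℝ) := Finset.sum_le_sum fun v _ => by
          simpa [hG v] using (hd v).2
      _ = _ := by simp [mul_comm]
  exact le_of_mul_le_mul_left (h2.trans h3) hκ0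

end

/-! ### Kraus maps and coset codes -/

section

/-- The completely positive map with the given Kraus operators. -/
def krausMap {ι n n' : Type} [Fintype ι] [Fintype n] (K : ι → Matrix n' n ℂ) :
    Op n →ₗ[ℂ] Op n' where
  toFun M := ∑ i, K i * M * (K i)ᴴ
  map_add' M M' := by simp [Matrix.mul_add, Matrix.add_mul, Finset.sum_add_distrib]
  map_smul' c M := by simp [Finset.smul_sum]

theorem krausMap_apply {ι n n' : Type} [Fintype ι] [Fintype n] (K : ι → Matrix n' n ℂ) (M : Op n) :
    krausMap K M = ∑ i, K i * M * (K i)ᴴ := rfl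

theorem isCPTP_krausMap {ι n n' : Type} [Fintype ι] [Fintype n] [DecidableEq n] [Fintype n']
    (K : ι → Matrix n' n ℂ) (hK : ∑ i, (K i)ᴴ * K i = 1) : IsCPTP (krausMap K) where
  completelyPositive k M hM := by
    let L : ι → Matrix (Fin k × n') (Fin k × n) ℂ :=
      fun i => Matrix.of fun p q => if p.1 = q.1 then K i p.2 q.2 else 0
    have h := Matrix.posSemidef_sum Finset.univ
      fun i (_ : i ∈ (Finset.univ : Finset ι)) => hM.mul_mul_conjTranspose_same (L i)
    convert h using 1
    ext ⟨a, x⟩ ⟨b, y⟩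
    simp [ampliation, krausMap, L, Matrix.sum_apply, Matrix.mul_apply, Fintype.sum_prod_type,
      Finset.sum_ite_irrel, apply_ite, ite_mul]
  tracePreserving M := by
    rw [krausMap_apply, Matrix.trace_sum]
    have h : ∀ i, (K i * M * (K i)ᴴ).trace = (M * ((K i)ᴴ * K i)).trace := fun i => by
      rw [Matrix.mul_assoc, Matrix.trace_mul_comm, Matrix.mul_assoc]
    simp only [h]
    rw [← Matrix.trace_sum, ← Matrix.mul_sum, hK, Matrix.mul_one]

theorem ampliation_id {R n : Type} (M : Op (R × n)) : ampliation R LinearMap.id M = M := rfl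

variable {V : Type} [Fintype V] [DecidableEq V]

/-- A coset code: the message `a` is encoded as the uniform superposition of the codewords `c` with
`msg c = a`. -/
theorem hasCode_of_codewords {E : Set (Finset V)} {d : V → ℕ} {n : ℕ} {C : Type} [Fintype C]
    [Nonempty C] (emb : C → JointBasis d) (msg : C → Fin n) (hE : E.Nonempty)
    (hbij : ∀ e ∈ E, Function.Bijective fun c => (fun v => emb c v : SubBasis d e))
    (hinj : ∀ e ∈ E, ∀ c c', msg c = msg c' → (∀ v, v ∉ e → emb c v = emb c' v) → c = c')
    (hsurj : ∀ e ∈ E, ∀ c a, ∃ c', msg c' = a ∧ ∀ v, v ∉ e → emb c' v = emb c v) :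
    HasCode E d n := by
  classical
  let Z : Finset V → Type := fun e => (v : {v // ¬ v ∈ e}) → Fin (d v)
  let env : (e : Finset V) → C → Z e := fun e c v => emb c v
  let ext : (e : Finset V) → e ∈ E → SubBasis d e ≃ C :=
    fun e he => (Equiv.ofBijective _ (hbij e he)).symm
  have hext : ∀ e he c, ext e he (fun v => emb c v) = c :=
    fun e he c => (Equiv.ofBijective _ (hbij e he)).symm_apply_apply c
  have hext' : ∀ e he σ v, emb (ext e he σ) v.1 = σ v := fun e he σ v =>
    congrFun ((Equiv.ofBijective _ (hbij e he)).apply_symm_apply σ) v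
  -- The decoder reads the codeword off `e`, rewrites it as the pair (message, part outside `e`),
  -- and discards the second component; z runs over the discarded value.
  let D : (e : Finset V) → e ∈ E → Z e → Matrix (Fin n) (SubBasis d e) ℂ := fun e he z =>
    Matrix.of fun a σ => if msg (ext e he σ) = a ∧ env e (ext e he σ) = z then 1 else 0
  -- Each z that occurs outside `e` occurs exactly once for every message, so the erased part
  -- carries no information about the message.
  let cnt : (e : Finset V) → Z e → ℂ := fun e z => if ∃ c, env e c = z then 1 else 0
  have hcnt : ∀ e ∈ E, ∀ a z, (∑ c, if msg c = a ∧ env e c = z then (1 : ℂ) else 0) = cnt e z := by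
    intro e he a z
    by_cases h : ∃ c, env e c = z
    · obtain ⟨c, hc⟩ := h
      obtain ⟨c', hc', hv⟩ := hsurj e he c a
      have hc'z : env e c' = z := by
        rw [← hc]; funext v; exact hv v v.2
      rw [Finset.sum_eq_single c']
      · rw [if_pos ⟨hc', hc'z⟩]
        exact (if_pos ⟨c, hc⟩).symm
      · intro c'' _ hne
        refine if_neg fun h => hne (hinj e he _ _ (h.1.trans hc'.symm) fun v hv => ?_)
        exact congrFun (h.2.trans hc'z.symm) ⟨v, hv⟩
      · simp
    · have : cnt e z = 0 := if_neg h
      rw [this]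
      exact Finset.sum_eq_zero fun c _ => if_neg fun hc => h ⟨c, hc.2⟩
  have hDD : ∀ e he z z', D e he z * (D e he z')ᴴ = if z = z' then cnt e z • 1 else 0 := by
    intro e he z z'
    ext a a'
    rw [Matrix.mul_apply, ← (ext e he).symm.sum_comp]
    simp only [D, Matrix.of_apply, Matrix.conjTranspose_apply, Equiv.apply_symm_apply]
    by_cases hz : z = z'
    · subst hz
      by_cases ha : a = a'
      · subst ha
        simp only [if_true, Matrix.smul_apply, Matrix.one_apply_eq, smul_eq_mul, mul_one,
          ← hcnt e he a z]
        exact Finset.sum_congr rfl fun c _ => by split_ifs <;> simp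
      · simp only [if_true, Matrix.smul_apply, Matrix.one_apply_ne ha, smul_zero]
        refine Finset.sum_eq_zero fun c _ => ?_
        split_ifs with h1 h2 <;> simp
        exact ha (h1.1.symm.trans h2.1)
    · simp only [if_neg hz, Matrix.zero_apply]
      refine Finset.sum_eq_zero fun c _ => ?_
      split_ifs with h1 h2 <;> simp
      exact hz (h1.2.symm.trans h2.2)
  have hDtp : ∀ e he, ∑ z, (D e he z)ᴴ * D e he z = 1 := by
    intro e he
    ext σ σ'
    simp only [Matrix.sum_apply, Matrix.mul_apply, D, Matrix.conjTranspose_apply, Matrix.of_apply]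
    by_cases h : σ = σ'
    · subst h
      rw [Finset.sum_eq_single (env e (ext e he σ))]
      · simp
      · intro z _ hz
        simp [Ne.symm hz]
      · simp
    · rw [Matrix.one_apply_ne h]
      refine Finset.sum_eq_zero fun z _ => Finset.sum_eq_zero fun a _ => ?_
      split_ifs with h1 h2 <;> simp
      refine h ((ext e he).injective (hinj e he _ _ (h1.1.trans h2.1.symm) fun v hv => ?_))
      exact congrFun (h1.2.trans h2.2.symm) ⟨v, hv⟩
  have htot : ∀ e ∈ E, ∑ z, cnt e z * n = Fintype.card C := by
    intro e he
    have : ∀ z, cnt e z * n = ∑ a, ∑ c, if msg c = a ∧ env e c = z then (1 : ℂ) else 0 := by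
      intro z
      simp [hcnt e he _ z, mul_comm]
    simp only [this]
    rw [(Finset.sum_congr rfl fun z _ => Finset.sum_comm).trans Finset.sum_comm]
    have h1 : ∀ c, ∑ z, (if env e c = z then (1 : ℂ) else 0) = 1 := fun c => by
      rw [Finset.sum_eq_single (env e c) (fun z _ hz => if_neg hz.symm) (by simp), if_pos rfl]
    simp [ite_and, h1]
  have hn : (n : ℂ) ≠ 0 := by
    obtain ⟨c⟩ := ‹Nonempty C›
    exact_mod_cast (Fin.pos (msg c)).ne'
  -- Each message has |C| / n codewords, so this amplitude normalises the superposition.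
  let w : ℝ := Real.sqrt (n / Fintype.card C)
  have hw : (w : ℂ) * w * (Fintype.card C / n) = 1 := by
    have hC : (Fintype.card C : ℂ) ≠ 0 := by exact_mod_cast Fintype.card_ne_zero
    rw [← Complex.ofReal_mul, Real.mul_self_sqrt (by positivity)]
    push_cast
    field_simp
  have hcntsum : ∀ e ∈ E, ∑ z, cnt e z = Fintype.card C / n := by
    intro e he
    rw [eq_div_iff hn, Finset.sum_mul, htot e he]
  let K : Matrix (JointBasis d) (Fin n) ℂ :=
    Matrix.of fun s a => if ∃ c, emb c = s ∧ msg c = a then (w : ℂ) else 0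
  -- The block of the encoder with outside part z is w times the adjoint of the decoder's Kraus
  -- operator; `hDD` then reduces the composite channel to a scalar multiple of the identity.
  have hK : ∀ e he σ z a, K ((Equiv.piEquivPiSubtypeProd (fun v => v ∈ e)
      fun v => Fin (d v)).symm (σ, z)) a = w * (D e he z)ᴴ σ a := by
    intro e he σ z a
    have : (∃ c, emb c = (Equiv.piEquivPiSubtypeProd (fun v => v ∈ e)
        fun v => Fin (d v)).symm (σ, z) ∧ msg c = a) ↔
        (msg (ext e he σ) = a ∧ env e (ext e he σ) = z) := by
      constructor
      · rintro ⟨c, hc, rfl⟩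
        have h1 : ext e he σ = c := by
          rw [← hext e he c]
          congr 1
          funext v
          rw [hc]
          simp [Equiv.piEquivPiSubtypeProd]
        rw [h1]
        refine ⟨rfl, ?_⟩
        funext v
        simp [env, hc, Equiv.piEquivPiSubtypeProd, v.2]
      · rintro ⟨h1, rfl⟩
        refine ⟨ext e he σ, ?_, h1⟩
        funext v
        by_cases hv : v ∈ e
        · simp [Equiv.piEquivPiSubtypeProd, hv, ← hext' e he σ ⟨v, hv⟩]
        · simp [Equiv.piEquivPiSubtypeProd, hv, env]
    simp only [K, Matrix.of_apply, this, D, Matrix.conjTranspose_apply]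
    split_ifs <;> simp
  obtain ⟨e₀, he₀⟩ := hE
  refine ⟨krausMap fun _ : Unit => K, isCPTP_krausMap _ ?_, fun e he =>
    ⟨krausMap (D e he), isCPTP_krausMap _ (hDtp e he), fun φ _ => ?_⟩⟩
  · have : Kᴴ * K = ∑ z, ((w : ℂ) * w) • (D e₀ he₀ z * (D e₀ he₀ z)ᴴ) := by
      ext a b
      rw [Matrix.mul_apply, ← (Equiv.piEquivPiSubtypeProd (fun v => v ∈ e₀)
        fun v => Fin (d v)).symm.sum_comp, Fintype.sum_prod_type_right, Matrix.sum_apply]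
      refine Finset.sum_congr rfl fun z _ => ?_
      rw [Matrix.smul_apply, Matrix.mul_apply, smul_eq_mul, Finset.mul_sum]
      refine Finset.sum_congr rfl fun σ _ => ?_
      rw [Matrix.conjTranspose_apply, hK e₀ he₀, hK e₀ he₀]
      simp [Complex.conj_ofReal]
      ring
    simp only [Finset.univ_unique, Finset.sum_const, Finset.card_singleton, one_smul, this, hDD,
      if_true]
    rw [← Finset.smul_sum, ← Finset.sum_smul, hcntsum e₀ he₀, smul_smul, hw, one_smul]
  · have herase : ∀ M, erase d e (krausMap (fun _ : Unit => K) M) =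
        ∑ z, ((w : ℂ) * w) • ((D e he z)ᴴ * M * D e he z) := by
      intro M
      ext x y
      rw [Matrix.sum_apply]
      refine Finset.sum_congr rfl fun z _ => ?_
      simp only [krausMap_apply, Finset.univ_unique, Finset.sum_const, Finset.card_singleton,
        one_smul, Matrix.mul_apply, Matrix.smul_apply, smul_eq_mul, Finset.mul_sum, Finset.sum_mul,
        Matrix.conjTranspose_apply K, hK e he]
      refine Finset.sum_congr rfl fun a _ => Finset.sum_congr rfl fun b _ => ?_
      simp [Complex.conj_ofReal]
      ring
    have hid : krausMap (D e he) ∘ₗ erase d e ∘ₗ krausMap (fun _ : Unit => K) = LinearMap.id := by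
      refine LinearMap.ext fun M => ?_
      have hz : ∀ z z', D e he z * ((D e he z')ᴴ * M * D e he z') * (D e he z)ᴴ =
          if z = z' then cnt e z • M else 0 := by
        intro z z'
        have : D e he z * ((D e he z')ᴴ * M * D e he z') * (D e he z)ᴴ =
          (D e he z * (D e he z')ᴴ) * M * (D e he z' * (D e he z)ᴴ) := by
          simp only [Matrix.mul_assoc]
        rw [this, hDD e he, hDD e he]
        by_cases h : z = z'
        · subst h
          by_cases hc : ∃ c, env e c = z <;> simp [cnt, hc]
        · simp [h]
      simp only [LinearMap.comp_apply, herase, map_sum, map_smul, LinearMap.id_apply]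
      simp only [krausMap_apply, hz]
      have h1 : ∀ z', ∑ z, (if z = z' then cnt e z • M else 0) = cnt e z' • M := fun z' => by
        rw [Finset.sum_eq_single z' (fun z _ hz => if_neg hz) (by simp), if_pos rfl]
      simp only [h1]
      rw [← Finset.smul_sum, ← Finset.sum_smul, hcntsum e he, smul_smul, hw, one_smul]
    rw [hid, ampliation_id]

end

/-! ### Cochains of the simplex in characteristic 2 -/

section Cochains

variable {I : Type} [DecidableEq I] {F : Type} [Field F]

/-- The coboundary operator on mod 2 cochains of the full simplex on `I`. -/
def coboundary (I F : Type) [DecidableEq I] [Field F] : (Finset I → F) →ₗ[F] (Finset I → F) where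
  toFun a S := ∑ j ∈ S, a (S.erase j)
  map_add' a b := by ext S; simp [Finset.sum_add_distrib]
  map_smul' r a := by ext S; simp [Finset.mul_sum]

/-- Contraction with the weight vector `w`. -/
def contract [Fintype I] (w : I → F) : (Finset I → F) →ₗ[F] (Finset I → F) where
  toFun a T := ∑ j ∈ Tᶜ, w j * a (insert j T)
  map_add' a b := by ext S; simp [Finset.sum_add_distrib, mul_add]
  map_smul' r a := by ext S; simp [Finset.mul_sum, mul_left_comm]

/-- Exterior multiplication by the vertex `i`. -/
def wedge (i : I) (a : Finset I → F) : Finset I → F :=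
  fun S => if i ∈ S then a (S.erase i) else 0

theorem coboundary_apply (a : Finset I → F) (S : Finset I) :
    coboundary I F a S = ∑ j ∈ S, a (S.erase j) := rfl

theorem contract_apply [Fintype I] (w : I → F) (a : Finset I → F) (T : Finset I) :
    contract w a T = ∑ j ∈ Tᶜ, w j * a (insert j T) := rfl

theorem wedge_zero (i : I) : wedge i (0 : Finset I → F) = 0 := by
  ext S; simp [wedge]

theorem sum_sum_erase_eq_zero [CharP F 2] (S : Finset I) (f : I → I → F)
    (hf : ∀ j k, f j k = f k j) : ∑ j ∈ S, ∑ k ∈ S.erase j, f j k = 0 := by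
  rw [Finset.sum_sigma']
  refine Finset.sum_involution (fun p _ => ⟨p.2, p.1⟩) ?_ ?_ ?_ ?_
  · rintro ⟨j, k⟩ _
    simp only
    rw [hf k j, CharTwo.add_self_eq_zero]
  · rintro ⟨j, k⟩ h _ h'
    simp only [Finset.mem_sigma, Finset.mem_erase] at h
    simp only [Sigma.mk.injEq, heq_eq_eq] at h'
    exact h.2.1 h'.1
  · rintro ⟨j, k⟩ h
    simp only [Finset.mem_sigma, Finset.mem_erase] at h ⊢
    exact ⟨h.2.2, h.2.1.symm, h.1⟩
  · rintro ⟨j, k⟩ _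
    rfl

theorem coboundary_coboundary [CharP F 2] (a : Finset I → F) :
    coboundary I F (coboundary I F a) = 0 := by
  ext S
  simp only [coboundary_apply, Pi.zero_apply]
  exact sum_sum_erase_eq_zero S (fun j k => a ((S.erase j).erase k))
    fun j k => by rw [Finset.erase_right_comm]

theorem contract_contract [Fintype I] [CharP F 2] (w : I → F) (a : Finset I → F) :
    contract w (contract w a) = 0 := by
  ext T
  simp only [contract_apply, Pi.zero_apply, Finset.mul_sum, Finset.compl_insert]
  refine sum_sum_erase_eq_zero Tᶜ (fun j k => w j * (w k * a (insert k (insert j T))))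
    fun j k => ?_
  rw [Finset.insert_comm]
  ring

/-- The Koszul homotopy formula: terms that replace a vertex of S by one outside occur in both
composites and cancel in characteristic 2, leaving the diagonal terms. -/
theorem coboundary_contract_add [Fintype I] [CharP F 2] (w : I → F) (a : Finset I → F) :
    coboundary I F (contract w a) + contract w (coboundary I F a) = (∑ j, w j) • a := by
  ext S
  have h1 : coboundary I F (contract w a) S = (∑ j ∈ S, w j) * a S +
      ∑ j ∈ S, ∑ k ∈ Sᶜ, w k * a (insert k (S.erase j)) := by
    rw [coboundary_apply, Finset.sum_mul, ← Finset.sum_add_distrib]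
    refine Finset.sum_congr rfl fun j hj => ?_
    rw [contract_apply, Finset.compl_erase, Finset.sum_insert (by simpa using hj),
      Finset.insert_erase hj]
  have h2 : contract w (coboundary I F a) S = (∑ k ∈ Sᶜ, w k) * a S +
      ∑ k ∈ Sᶜ, ∑ j ∈ S, w k * a (insert k (S.erase j)) := by
    rw [contract_apply, Finset.sum_mul, ← Finset.sum_add_distrib]
    refine Finset.sum_congr rfl fun k hk => ?_
    have hk' : k ∉ S := by simpa using hk
    rw [coboundary_apply, Finset.sum_insert hk', Finset.erase_insert hk', mul_add, Finset.mul_sum]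
    congr 1
    refine Finset.sum_congr rfl fun j hj => ?_
    rw [Finset.erase_insert_of_ne]
    rintro rfl
    exact hk' hj
  rw [Pi.add_apply, h1, h2, Finset.sum_comm (s := Sᶜ), add_add_add_comm, CharTwo.add_self_eq_zero,
    add_zero, ← add_mul, Finset.sum_add_sum_compl, Pi.smul_apply, smul_eq_mul]

theorem coboundary_wedge (i : I) (a : Finset I → F) :
    coboundary I F (wedge i a) = wedge i (coboundary I F a) := by
  ext S
  simp only [coboundary_apply, wedge]
  split_ifs with h
  · rw [← Finset.add_sum_erase S _ h]
    simp only [Finset.notMem_erase, if_false, zero_add]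
    refine Finset.sum_congr rfl fun k hk => ?_
    rw [if_pos (Finset.mem_erase.2 ⟨(Finset.ne_of_mem_erase hk).symm, h⟩),
      Finset.erase_right_comm]
  · refine Finset.sum_eq_zero fun k _ => if_neg fun h' => h (Finset.mem_of_mem_erase h')

theorem contract_wedge [Fintype I] [CharP F 2] (w : I → F) (i : I) (a : Finset I → F) :
    contract w (wedge i a) = w i • a + wedge i (contract w a) := by
  ext T
  simp only [contract_apply, wedge, Pi.add_apply, Pi.smul_apply, smul_eq_mul]
  by_cases h : i ∈ T
  · rw [if_pos h, Finset.compl_erase, Finset.sum_insert (by simpa using h),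
      Finset.insert_erase h, ← add_assoc, CharTwo.add_self_eq_zero, zero_add]
    refine Finset.sum_congr rfl fun k hk => ?_
    have hk' : k ≠ i := by rintro rfl; simp [h] at hk
    rw [if_pos (Finset.mem_insert_of_mem h), Finset.erase_insert_of_ne hk']
  · rw [if_neg h, add_zero, Finset.sum_eq_single i]
    · simp [h]
    · intro k _ hk
      simp [h, hk.symm]
    · simp [h]

/-- The cochains that vanish outside the sets of cardinality `n`. -/
def homogeneous (I F : Type) [Field F] (n : ℕ) : Submodule F (Finset I → F) where
  carrier := {a | ∀ S, S.card ≠ n → a S = 0}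
  zero_mem' := fun _ _ => rfl
  add_mem' := fun ha hb S hS => by simp [ha S hS, hb S hS]
  smul_mem' := fun r a ha S hS => by simp [ha S hS]

theorem coboundary_mem_homogeneous {n : ℕ} {a : Finset I → F} (ha : a ∈ homogeneous I F n) :
    coboundary I F a ∈ homogeneous I F (n + 1) := by
  intro S hS
  refine Finset.sum_eq_zero fun j hj => ha _ fun h => hS ?_
  rw [← Finset.card_erase_add_one hj, h]

theorem contract_mem_homogeneous [Fintype I] (w : I → F) {n : ℕ} {a : Finset I → F}
    (ha : a ∈ homogeneous I F (n + 1)) : contract w a ∈ homogeneous I F n := by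
  intro T hT
  refine Finset.sum_eq_zero fun j hj => ?_
  rw [ha, mul_zero]
  rw [Finset.card_insert_of_notMem (by simpa using hj)]
  omega

theorem wedge_mem_homogeneous (i : I) {n : ℕ} {a : Finset I → F} (ha : a ∈ homogeneous I F n) :
    wedge i a ∈ homogeneous I F (n + 1) := by
  intro S hS
  unfold wedge
  split_ifs with h
  · refine ha _ fun h' => hS ?_
    rw [← Finset.card_erase_add_one h, h']
  · rfl

/-- The cocycles of degree `n`. -/
def cocycles (I F : Type) [DecidableEq I] [Field F] (n : ℕ) : Submodule F (Finset I → F) :=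
  homogeneous I F n ⊓ LinearMap.ker (coboundary I F)

/-- The cocycles of degree `n` that are annihilated by the contraction with `w`. -/
def primitiveCocycles [Fintype I] (w : I → F) (n : ℕ) : Submodule F (Finset I → F) :=
  cocycles I F n ⊓ LinearMap.ker (contract w)

/-- For i ∉ S, the cocycle condition at `insert i S` expresses c S through values on the star of i.
-/
theorem eq_zero_of_coboundary_eq_zero (i : I) {c : Finset I → F} (hc : coboundary I F c = 0)
    (h : ∀ S, i ∈ S → c S = 0) : c = 0 := by
  ext S
  by_cases hS : i ∈ S
  · exact h S hS
  have h1 := congrFun hc (insert i S)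
  rw [coboundary_apply, Finset.sum_insert hS, Finset.erase_insert hS, Finset.sum_eq_zero,
    add_zero] at h1
  · exact h1
  · intro j hj
    refine h _ (Finset.mem_erase.2 ⟨?_, Finset.mem_insert_self _ _⟩)
    rintro rfl
    exact hS hj

/-- Dually, for i ∈ S, vanishing of the contraction at `S.erase i` expresses w i * c S through
values off the star of i. -/
theorem eq_zero_of_contract_eq_zero [Fintype I] {w : I → F} {i : I} (hw : w i ≠ 0) {c : Finset I → F}
    (hc : contract w c = 0) (h : ∀ S, i ∉ S → c S = 0) : c = 0 := by
  ext S
  by_cases hS : i ∈ S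
  · have h1 := congrFun hc (S.erase i)
    rw [contract_apply, Finset.sum_eq_single i, Finset.insert_erase hS] at h1
    · exact (mul_eq_zero.1 h1).resolve_left hw
    · intro k _ hk
      rw [h _ (by simp [hk.symm]), mul_zero]
    · simp
  · exact h S hS

/-- A cocycle has arbitrary values on the star of a vertex. -/
theorem exists_cocycle_of_star [CharP F 2] (i : I) {n : ℕ} {g : Finset I → F}
    (hg : g ∈ homogeneous I F (n + 1)) :
    ∃ c ∈ cocycles I F (n + 1), ∀ S, i ∈ S → c S = g S := by
  let a : Finset I → F := fun T => if i ∈ T then 0 else g (insert i T)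
  have ha : a ∈ homogeneous I F n := by
    intro T hT
    simp only [a]
    split_ifs with h
    · rfl
    · refine hg _ ?_
      rw [Finset.card_insert_of_notMem h]
      omega
  refine ⟨coboundary I F a, ⟨coboundary_mem_homogeneous ha, coboundary_coboundary a⟩,
    fun S hS => ?_⟩
  rw [coboundary_apply, Finset.sum_eq_single i]
  · simp [a, Finset.insert_erase hS]
  · intro j _ hj
    exact if_pos (Finset.mem_erase.2 ⟨hj.symm, hS⟩)
  · exact fun h => absurd hS h

theorem contract_mem_primitiveCocycles [Fintype I] [CharP F 2] {w : I → F} (hw : ∑ j, w j = 0) {n : ℕ}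
    {c : Finset I → F} (hc : c ∈ cocycles I F (n + 1)) :
    contract w c ∈ primitiveCocycles w n := by
  refine ⟨⟨contract_mem_homogeneous w hc.1, ?_⟩, contract_contract w c⟩
  have h := coboundary_contract_add w c
  rwa [LinearMap.mem_ker.1 hc.2, map_zero, add_zero, hw, zero_smul] at h

/-- Every primitive cocycle is the contraction of a cocycle supported on the star of `i`. -/
theorem exists_contract_eq [Fintype I] [CharP F 2] {w : I → F} {i : I} (hw : w i ≠ 0) {n : ℕ}
    {b : Finset I → F} (hb : b ∈ primitiveCocycles w n) :
    ∃ c ∈ cocycles I F (n + 1), contract w c = b ∧ ∀ S, i ∉ S → c S = 0 := by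
  refine ⟨(w i)⁻¹ • wedge i b, Submodule.smul_mem _ _ ⟨wedge_mem_homogeneous i hb.1.1, ?_⟩, ?_,
    fun S hS => by simp [wedge, hS]⟩
  · refine LinearMap.mem_ker.2 ?_
    rw [coboundary_wedge, LinearMap.mem_ker.1 hb.1.2, wedge_zero]
  · rw [map_smul, contract_wedge, LinearMap.mem_ker.1 hb.2, wedge_zero, add_zero, smul_smul,
      inv_mul_cancel₀ hw, one_smul]

/-- The free coordinates of a primitive cocycle are its values on sets containing i but not j:
contraction yields the sets containing both, and the cocycle condition yields those avoiding i. This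
gives the dimension of the message space. -/
theorem bijective_primitiveCocycles_link [Fintype I] [CharP F 2] {w : I → F} (hw : ∑ j, w j = 0) {i j : I}
    (hij : i ≠ j) (hwj : w j ≠ 0) (n : ℕ) :
    Function.Bijective fun (b : primitiveCocycles w (n + 1))
      (T : Finset.powersetCard n ({i, j}ᶜ : Finset I)) => b.1 (insert i T.1) := by
  constructor
  · intro b b' hbb
    have hd := (primitiveCocycles w (n + 1)).sub_mem b.2 b'.2
    have hv : ∀ S, i ∈ S → j ∉ S → (b.1 - b'.1) S = 0 := by
      intro S hi hj
      by_cases hS : S.card = n + 1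
      · have h := congrFun hbb ⟨S.erase i, Finset.mem_powersetCard.2 ⟨fun k hk => ?_, ?_⟩⟩
        · simpa [Finset.insert_erase hi, sub_eq_zero] using h
        · simp only [Finset.mem_compl, Finset.mem_insert, Finset.mem_singleton, not_or]
          refine ⟨Finset.ne_of_mem_erase hk, ?_⟩
          rintro rfl
          exact hj (Finset.mem_of_mem_erase hk)
        · rw [Finset.card_erase_of_mem hi, hS]
          rfl
      · exact hd.1.1 S hS
    have hz := eq_zero_of_coboundary_eq_zero i hd.1.2 fun S hi => by
      by_cases hj : j ∈ S
      · have h1 := congrFun (LinearMap.mem_ker.1 hd.2) (S.erase j)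
        rw [contract_apply, Finset.sum_eq_single j, Finset.insert_erase hj] at h1
        · exact (mul_eq_zero.1 h1).resolve_left hwj
        · intro k _ hk
          rw [hv _ (Finset.mem_insert_of_mem (Finset.mem_erase.2 ⟨hij, hi⟩))
            (by simp [hk.symm]), mul_zero]
        · simp
      · exact hv S hi hj
    exact Subtype.ext (sub_eq_zero.1 hz)
  · intro f
    let a : Finset I → F := fun T =>
      if h : T ∈ Finset.powersetCard n ({i, j}ᶜ : Finset I) then f ⟨T, h⟩ else 0
    have ha : a ∈ homogeneous I F n := fun T hT =>
      dif_neg fun h => hT (Finset.mem_powersetCard.1 h).2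
    have hwa := contract_mem_homogeneous w (wedge_mem_homogeneous j ha)
    -- The coboundary makes this closed. The homotopy formula with zero total weight makes it
    -- primitive, since the inner cochain is already a contraction.
    let b := (w j)⁻¹ • coboundary I F (contract w (wedge j a))
    have hb : b ∈ primitiveCocycles w (n + 1) := by
      refine Submodule.smul_mem _ _ ⟨⟨coboundary_mem_homogeneous hwa, coboundary_coboundary _⟩, ?_⟩
      have h := coboundary_contract_add w (contract w (wedge j a))
      rwa [contract_contract, map_zero, zero_add, hw, zero_smul] at h
    refine ⟨⟨b, hb⟩, funext fun T => ?_⟩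
    have hT : ∀ k ∈ T.1, k ≠ i ∧ k ≠ j := fun k hk => by
      simpa using (Finset.mem_powersetCard.1 T.2).1 hk
    have hiT : i ∉ T.1 := fun h => (hT i h).1 rfl
    have hjT : j ∉ T.1 := fun h => (hT j h).2 rfl
    have hU : ∀ U, j ∉ U → contract w (wedge j a) U = w j * a U := by
      intro U hU
      rw [contract_wedge]
      simp [wedge, hU]
    simp only [b, Pi.smul_apply, coboundary_apply, smul_eq_mul]
    rw [Finset.sum_insert hiT, Finset.erase_insert hiT, Finset.sum_eq_zero, add_zero, hU _ hjT,
      inv_mul_cancel_left₀ hwj]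
    · exact dif_pos T.2
    · intro l hl
      rw [hU _ (by simp [hij.symm, hjT])]
      have : a ((insert i T.1).erase l) = 0 := by
        refine dif_neg fun h => ?_
        have := (Finset.mem_powersetCard.1 h).1
          (Finset.mem_erase.2 ⟨(hT l hl).1.symm, Finset.mem_insert_self _ _⟩)
        simp at this
      rw [this, mul_zero]

theorem card_primitiveCocycles [Fintype I] [CharP F 2] [Finite F] {w : I → F} (hw : ∑ j, w j = 0) {i j : I}
    (hij : i ≠ j) (hwj : w j ≠ 0) (n : ℕ) :
    Nat.card (primitiveCocycles w (n + 1)) = Nat.card F ^ (Fintype.card I - 2).choose n := by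
  rw [Nat.card_eq_of_bijective _ (bijective_primitiveCocycles_link hw hij hwj n), Nat.card_fun]
  congr 1
  rw [Nat.card_eq_fintype_card, Fintype.card_coe, Finset.card_powersetCard, Finset.card_compl,
    Finset.card_pair hij]

/-- A nonzero t splits as t * x + t * (1 - x) with both parts nonzero as soon as x is neither 0 nor
1. -/
theorem exists_ne_zero_sum_eq (hF : ∃ x : F, x ≠ 0 ∧ x ≠ 1) (n : ℕ) (t : F) (ht : t ≠ 0) :
    ∃ w : Fin (n + 1) → F, (∀ i, w i ≠ 0) ∧ ∑ i, w i = t := by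
  induction n generalizing t with
  | zero => exact ⟨fun _ => t, fun _ => ht, by simp⟩
  | succ n ih =>
    obtain ⟨x, hx0, hx1⟩ := hF
    obtain ⟨w, hw, hs⟩ := ih (t * (1 - x)) (mul_ne_zero ht (sub_ne_zero.2 hx1.symm))
    refine ⟨Fin.cons (t * x) w, fun i => ?_, ?_⟩
    · refine Fin.cases ?_ (fun i => ?_) i
      · simpa using ⟨ht, hx0⟩
      · simpa using hw i
    · rw [Fin.sum_univ_succ]
      simp only [Fin.cons_zero, Fin.cons_succ, hs]
      ring

theorem exists_ne_zero_sum_eq_zero (hF : ∃ x : F, x ≠ 0 ∧ x ≠ 1) (n : ℕ) :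
    ∃ w : Fin (n + 2) → F, (∀ i, w i ≠ 0) ∧ ∑ i, w i = 0 := by
  obtain ⟨w, hw, hs⟩ := exists_ne_zero_sum_eq hF n (-1) (neg_ne_zero.2 one_ne_zero)
  refine ⟨Fin.cons 1 w, fun i => ?_, by rw [Fin.sum_univ_succ]; simp [hs]⟩
  refine Fin.cases ?_ (fun i => ?_) i
  · simp
  · simpa using hw i

end Cochains

/-! ### The code on the intersection graph, and the capacity -/

/-- The three conditions on the coset code are, in turn, freeness of cocycles on a star, injectivity
of contraction on cocycles supported there, and its surjectivity from them onto primitive cocycles.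
-/
theorem intersectionGraph_hasCode {V : Type} [Fintype V] [DecidableEq V] {Δ n : ℕ} (hΔ : 2 ≤ Δ)
    (π : {S : Finset (Fin Δ) // S.card = n + 2} ≃ V) (size : V → ℝ) {F : Type} [Field F]
    [CharP F 2] [Finite F] (hF : ∃ x : F, x ≠ 0 ∧ x ≠ 1) :
    HasCode (intersectionGraph π size).decodingSets (fun _ => Nat.card F)
      (Nat.card F ^ (Δ - 2).choose n) := by
  classical
  obtain ⟨w, hw, hws⟩ : ∃ w : Fin Δ → F, (∀ i, w i ≠ 0) ∧ ∑ i, w i = 0 := by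
    obtain ⟨k, rfl⟩ := Nat.exists_eq_add_of_le' hΔ
    exact exists_ne_zero_sum_eq_zero hF k
  have hcard : Nat.card (primitiveCocycles w (n + 1)) = Nat.card F ^ (Δ - 2).choose n := by
    have := card_primitiveCocycles hws (i := ⟨0, by omega⟩) (j := ⟨1, by omega⟩) (by simp) (hw _) n
    rwa [Fintype.card_fin] at this
  let φ : F ≃ Fin (Nat.card F) := Finite.equivFin F
  let ψ : primitiveCocycles w (n + 1) ≃ Fin (Nat.card F ^ (Δ - 2).choose n) :=
    Finite.equivFinOfCardEq hcard
  let C := cocycles (Fin Δ) F (n + 2)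
  have : Fintype C := Fintype.ofFinite C
  have hmem : ∀ i v, v ∈ Finset.univ.filter (fun v : V => i ∈ (π.symm v).1) ↔ i ∈ (π.symm v).1 :=
    fun i v => by simp
  refine hasCode_of_codewords (C := C) (fun c v => φ (c.1 (π.symm v).1))
    (fun c => ψ ⟨contract w c.1, contract_mem_primitiveCocycles hws c.2⟩)
    ⟨_, ⟨⟨0, by omega⟩, rfl⟩⟩ ?_ ?_ ?_
  · rintro _ ⟨i, rfl⟩
    constructor
    · intro c c' h
      have hd := C.sub_mem c.2 c'.2
      refine Subtype.ext (sub_eq_zero.1 (eq_zero_of_coboundary_eq_zero i hd.2 fun S hS => ?_))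
      by_cases hc : S.card = n + 2
      · have h1 := congrFun h ⟨π ⟨S, hc⟩, (hmem _ _).2 (by simpa using hS)⟩
        simpa [sub_eq_zero] using h1
      · exact hd.1 S hc
    · intro σ
      let g : Finset (Fin Δ) → F := fun S => if h : S.card = n + 2 then if h' : i ∈ S then
        φ.symm (σ ⟨π ⟨S, h⟩, (hmem _ _).2 (by simpa using h')⟩) else 0 else 0
      have hg : g ∈ homogeneous (Fin Δ) F (n + 2) := fun S hS => dif_neg hS
      obtain ⟨c, hc, hcg⟩ := exists_cocycle_of_star i hg
      refine ⟨⟨c, hc⟩, funext fun v => ?_⟩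
      have hv := (hmem _ _).1 v.2
      have hg' : g (π.symm v.1).1 = φ.symm (σ v) := by
        simp only [g]
        rw [dif_pos (π.symm v.1).2, dif_pos hv]
        congr 2
        exact Subtype.ext (π.apply_symm_apply v.1)
      simp [hcg _ hv, hg']
  · rintro _ ⟨i, rfl⟩ c c' h hv
    have hd := C.sub_mem c.2 c'.2
    refine Subtype.ext (sub_eq_zero.1 (eq_zero_of_contract_eq_zero (hw i) ?_ fun S hS => ?_))
    · rw [map_sub, sub_eq_zero]
      exact congrArg Subtype.val (ψ.injective h)
    · by_cases hc : S.card = n + 2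
      · have h1 := hv (π ⟨S, hc⟩) (by rw [hmem]; simpa using hS)
        simpa [sub_eq_zero] using h1
      · exact hd.1 S hc
  · rintro _ ⟨i, rfl⟩ c a
    have hb := (primitiveCocycles w (n + 1)).sub_mem (ψ.symm a).2
      (contract_mem_primitiveCocycles hws c.2)
    obtain ⟨k, hk, hkb, hk0⟩ := exists_contract_eq (hw i) hb
    refine ⟨⟨c.1 + k, C.add_mem c.2 hk⟩, ?_, fun v hv => ?_⟩
    · rw [← ψ.eq_symm_apply]
      refine Subtype.ext ?_
      simp [hkb]
    · rw [hmem] at hv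
      simp [hk0 _ hv]

theorem hasCode_trivial {V : Type} [Fintype V] [DecidableEq V] {E : Set (Finset V)}
    (hE : E.Nonempty) : HasCode E (fun _ => 1) 1 := by
  refine hasCode_of_codewords (C := Unit) (fun _ _ => 0) (fun _ => 0) hE ?_ ?_ ?_
  · intro e _
    exact ⟨fun _ _ _ => rfl, fun σ => ⟨(), Subsingleton.elim _ _⟩⟩
  · intros; rfl
  · intro e _ c a
    exact ⟨(), Subsingleton.elim _ _, fun _ _ => rfl⟩

theorem StorageGraph.Fits.le_capacity {V : Type} [Fintype V] [DecidableEq V] {G : StorageGraph V}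
    {q κ : ℕ} {l : ℝ} (hq : 2 ≤ q) (hκ : 1 ≤ κ) (h : G.Fits q κ l) : (l : EReal) ≤ G.capacity :=
  le_iSup₂_of_le q hq <| le_iSup₂_of_le κ hκ <| le_iSup₂_of_le l h le_rfl

/-- Two distinct decoding sets of the intersection graph share `(Δ - 2).choose (m - 2)` nodes. -/
theorem card_filter_mem_and_mem {V : Type} [Fintype V] {Δ m : ℕ}
    (π : {S : Finset (Fin Δ) // S.card = m} ≃ V) {i j : Fin Δ} (hij : i ≠ j) :
    (Finset.univ.filter fun v : V => i ∈ (π.symm v).1 ∧ j ∈ (π.symm v).1).card =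
      if 2 ≤ m then (Δ - 2).choose (m - 2) else 0 := by
  split_ifs with hm
  · have h2 : (Finset.powersetCard (m - 2) ({i, j}ᶜ : Finset (Fin Δ))).card =
        (Δ - 2).choose (m - 2) := by
      rw [Finset.card_powersetCard, Finset.card_compl, Finset.card_pair hij, Fintype.card_fin]
    rw [← h2]
    have hsub : ∀ v, i ∈ (π.symm v).1 ∧ j ∈ (π.symm v).1 →
        ({i, j} : Finset (Fin Δ)) ⊆ (π.symm v).1 := by
      intro v hv
      simp [Finset.insert_subset_iff, hv]
    refine Finset.card_bij (fun v _ => (π.symm v).1 \ {i, j}) ?_ ?_ ?_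
    · intro v hv
      simp only [Finset.mem_filter, Finset.mem_univ, true_and] at hv
      rw [Finset.mem_powersetCard, Finset.card_sdiff_of_subset (hsub v hv), Finset.card_pair hij,
        (π.symm v).2]
      refine ⟨fun k hk => ?_, rfl⟩
      simpa using (Finset.mem_sdiff.1 hk).2
    · intro v hv v' hv' h
      simp only [Finset.mem_filter, Finset.mem_univ, true_and] at hv hv'
      refine π.symm.injective (Subtype.ext ?_)
      rw [← Finset.sdiff_union_of_subset (hsub v hv), h, Finset.sdiff_union_of_subset (hsub v' hv')]
    · intro T hT
      rw [Finset.mem_powersetCard] at hT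
      have hd : Disjoint T {i, j} := Finset.subset_compl_iff_disjoint_right.1 hT.1
      refine ⟨π ⟨T ∪ {i, j}, ?_⟩, ?_, ?_⟩
      · rw [Finset.card_union_of_disjoint hd, Finset.card_pair hij, hT.2]
        omega
      · simp
      · simp only [Equiv.symm_apply_apply]
        exact Finset.union_sdiff_cancel_right hd
  · rw [Finset.card_eq_zero, Finset.filter_eq_empty_iff]
    rintro v - ⟨hi, hj⟩
    have := Finset.one_lt_card.2 ⟨i, hi, j, hj, hij⟩
    rw [(π.symm v).2] at this
    omega

end QStorage

end

theorem theorem6 (Δ m : ℕ) (hm : 1 ≤ m) (hΔ : m < Δ)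
    (π : {S : Finset (Fin Δ) // S.card = m} ≃ Fin (Δ.choose m)) :
    (QStorage.intersectionGraph π fun _ => 1).capacity =
      ((if 2 ≤ m then (Δ - 2).choose (m - 2) else 0 : ℕ) : EReal) := by
  have hcast : ∀ l : ℕ, (l : EReal) = ((l : ℝ) : EReal) := fun l => by simp
  apply le_antisymm
  · refine iSup₂_le fun q hq => iSup₂_le fun κ hκ => iSup₂_le fun l hl => ?_
    have hij : (⟨0, by omega⟩ : Fin Δ) ≠ ⟨1, by omega⟩ := by simp
    have h := hl.le_card_inter hq hκ (fun _ => rfl) ⟨⟨0, by omega⟩, rfl⟩ ⟨⟨1, by omega⟩, rfl⟩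
    rw [← Finset.filter_and, QStorage.card_filter_mem_and_mem π hij] at h
    rw [hcast]
    exact EReal.coe_le_coe_iff.2 h
  · rw [hcast]
    rcases Nat.lt_or_ge m 2 with h | h
    · rw [if_neg (by omega)]
      refine QStorage.StorageGraph.Fits.le_capacity (q := 2) (κ := 1) le_rfl le_rfl
        ⟨fun _ => 1, 1, fun v => ?_, by simp, QStorage.hasCode_trivial ⟨_, ⟨⟨0, by omega⟩, rfl⟩⟩⟩
      simp [QStorage.intersectionGraph]
    · obtain ⟨n, rfl⟩ := Nat.exists_eq_add_of_le' h
      rw [if_pos h]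
      -- Over the field with two elements the only nowhere-zero weight is constantly 1, whose sum is
      -- nonzero for odd Δ; the field with four elements works for every Δ ≥ 2.
      have hcard : Nat.card (GaloisField 2 2) = 4 := by
        rw [GaloisField.card 2 2 two_ne_zero]
        norm_num
      have hF : ∃ x : GaloisField 2 2, x ≠ 0 ∧ x ≠ 1 := by
        classical
        have := Fintype.ofFinite (GaloisField 2 2)
        by_contra! hx
        have h1 : (Finset.univ : Finset (GaloisField 2 2)) ⊆ {0, 1} := fun x _ => by
          by_cases h0 : x = 0
          · simp [h0]
          · simp [hx x h0]
        have h2 := (Finset.card_le_card h1).trans Finset.card_le_two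
        rw [Finset.card_univ, ← Nat.card_eq_fintype_card, hcard] at h2
        omega
      have hcode := QStorage.intersectionGraph_hasCode (by omega) π (fun _ => 1) hF
      rw [hcard] at hcode
      refine QStorage.StorageGraph.Fits.le_capacity (q := 4) (κ := 1) (by norm_num) le_rfl
        ⟨fun _ => 4, _, fun v => ?_, ⟨by positivity, ?_⟩, hcode⟩
      · simp [QStorage.intersectionGraph]
      · simp [Real.logb_pow]
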